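/- Let $F_i(x)=\lambda x+b_i$ $(1\le i\le A)$ and $G_j(x)=\gamma x+c_j$ $(1\le j\le B)$ be two finite iterated function systems on $\mathbb{R}$, each consisting of orientation-preserving affine contractions with one common contraction rate, $0<\lambda<1$ and $0<\gamma<1$ respectively. Let $C_\lambda$ and $C_\gamma$ be their attractors, i.e. the nonempty compact sets with $C_\lambda=\bigcup_{i}F_i(C_\lambda)$ and $C_\gamma=\bigcup_{j}G_j(C_\gamma)$, and suppose that both have closed convex hull $[0,1]$. Let $d_\lambda$ and $d_\gamma$ be the similarity dimensions of the two systems, i.e. the real numbers with $A\lambda^{d_\lambda}=1$ and $B\gamma^{d_\gamma}=1$. Then the arithmetic sum $C_\lambda+C_\gamma=\{x+y : x\in C_\lambda,\ y\in C_\gamma\}$ satisfies $$\mathcal{H}^{d_\lambda+d_\gamma}(C_\lambda+C_\gamma)=0,$$ where $\mathcal{H}^{s}$ denotes $s$-dimensional Hausdorff measure. -/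

import Mathlib

open scoped Pointwise

/-- An iterated function system on the real line with finitely many linear contractions
`x ↦ O i * l i * x + b i`, where `O i = ± 1` is the orientation and `0 < l i < 1` is the
contraction rate of the `i`-th map. -/
structure AffineIFS (ι : Type*) where
  /-- the contraction rates -/
  rate : ι → ℝ
  /-- the orientations -/
  orient : ι → ℝ
  /-- the translation parts -/
  shift : ι → ℝ
  rate_pos : ∀ i, 0 < rate i
  rate_lt_one : ∀ i, rate i < 1
  orient_eq : ∀ i, orient i = 1 ∨ orient i = -1

namespace AffineIFS

variable {ι : Type*}

/-- The `i`-th contraction of the system. -/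
def map (F : AffineIFS ι) (i : ι) (x : ℝ) : ℝ :=
  F.orient i * F.rate i * x + F.shift i

/-- `C` is the attractor of the system: the nonempty compact set that is the union of its images
under the maps of the system. -/
def IsAttractor (F : AffineIFS ι) (C : Set ℝ) : Prop :=
  C.Nonempty ∧ IsCompact C ∧ C = ⋃ i, F.map i '' C

/-- All contraction rates are the same. -/
def IsHomogeneous (F : AffineIFS ι) : Prop :=
  ∀ i j, F.rate i = F.rate j

/-- All maps preserve the orientation. -/
def IsOrientationPreserving (F : AffineIFS ι) : Prop :=
  ∀ i, F.orient i = 1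

/-- `d` is the similarity dimension: the sum of the `d`-th powers of the contraction rates
is `1`. -/
def IsSimilarityDimension [Fintype ι] (F : AffineIFS ι) (d : ℝ) : Prop :=
  ∑ i, F.rate i ^ d = 1

end AffineIFS

open MeasureTheory Filter Topology

/-! Put `s = d₁ + d₂` and let `f t` be the Hausdorff content of `C₁ + t • C₂`. With `u = γ^m / λ^n`,
cutting `C₁` at level `n` and `C₂` at level `m` writes `C₁ + t • C₂` as `A^n B^m` copies of `C₁ + (t
u) • C₂` scaled by `λ^n`. The choice of `s` turns subadditivity into `u^d₂ f(t) ≤ f(t u)`.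

Such ratios return arbitrarily close to `1` with arbitrarily large exponents
(`frequently_pow_div_pow_nhds_one`), and content is upper semicontinuous on compact sets. Following
`u` by another ratio back to near `1` therefore gives the reverse bound `f(u) ≤ u^d₂ f(1)`. So
covering `C₁ + C₂` piece by piece wastes nothing.

But for `u` near `1` some waste is visible (`hausdorffContent_add_add_le`): two corner pieces nearly
coincide, so one cover of content about `f(1)`, after rescaling, serves both, instead of about `2
f(1)`. This forces `f(1) = 0`, and null content means null Hausdorff measure. -/

/-! ### Hausdorff content on the line. -/

/-- The `s`-dimensional Hausdorff content on the real line: the outer measure obtained from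
coverings by sets of arbitrary diameter. -/
noncomputable def hausdorffContent (s : ℝ) : OuterMeasure ℝ :=
  OuterMeasure.boundedBy fun E => Metric.ediam E ^ s

theorem hausdorffContent_apply {s : ℝ} (hs : 0 < s) (E : Set ℝ) :
    hausdorffContent s E =
      ⨅ (t : ℕ → Set ℝ) (_ : E ⊆ ⋃ i, t i), ∑' i, Metric.ediam (t i) ^ s := by
  have h0 : (fun E : Set ℝ => Metric.ediam E ^ s) ∅ = 0 := by
    simp [ENNReal.zero_rpow_of_pos hs]
  rw [hausdorffContent, OuterMeasure.boundedBy_eq_ofFunction h0, OuterMeasure.ofFunction_apply]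

theorem hausdorffContent_le_tsum {s : ℝ} (hs : 0 < s) {E : Set ℝ} {t : ℕ → Set ℝ}
    (h : E ⊆ ⋃ i, t i) : hausdorffContent s E ≤ ∑' i, Metric.ediam (t i) ^ s := by
  rw [hausdorffContent_apply hs]
  exact iInf₂_le t h

theorem exists_cover_of_hausdorffContent_lt {s : ℝ} (hs : 0 < s) {E : Set ℝ} {c : ENNReal}
    (h : hausdorffContent s E < c) :
    ∃ t : ℕ → Set ℝ, E ⊆ ⋃ i, t i ∧ ∑' i, Metric.ediam (t i) ^ s < c := by
  rw [hausdorffContent_apply hs] at h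
  simpa only [iInf_lt_iff, exists_prop] using h

theorem hausdorffContent_image_le {s : ℝ} (hs : 0 < s) {K : NNReal} (hK : K ≠ 0) {f : ℝ → ℝ}
    (hf : LipschitzWith K f) (E : Set ℝ) :
    hausdorffContent s (f '' E) ≤ (K : ENNReal) ^ s * hausdorffContent s E := by
  have hK0 : (K : ENNReal) ^ s ≠ 0 :=
    (ENNReal.rpow_pos (by exact_mod_cast hK.bot_lt) ENNReal.coe_ne_top).ne'
  have hK1 : (K : ENNReal) ^ s ≠ ⊤ := ENNReal.rpow_ne_top_of_nonneg hs.le ENNReal.coe_ne_top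
  rw [mul_comm, ← ENNReal.div_le_iff hK0 hK1, hausdorffContent_apply hs E]
  refine le_iInf₂ fun t ht => ?_
  rw [ENNReal.div_le_iff hK0 hK1, mul_comm, ← ENNReal.tsum_mul_left]
  have h : f '' E ⊆ ⋃ i, f '' t i := by
    rw [← Set.image_iUnion]
    exact Set.image_mono ht
  refine (hausdorffContent_le_tsum hs h).trans (ENNReal.tsum_le_tsum fun i => ?_)
  rw [← ENNReal.mul_rpow_of_nonneg _ _ hs.le]
  exact ENNReal.rpow_le_rpow (hf.ediam_image_le _) hs.le

/-- Scaling of the Hausdorff content under the similarity `x ↦ r * x + b`. -/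
theorem hausdorffContent_image_mul_add_le {s r : ℝ} (hs : 0 < s) (hr : 0 < r) (b : ℝ)
    (E : Set ℝ) :
    hausdorffContent s ((fun x => r * x + b) '' E) ≤
      ENNReal.ofReal (r ^ s) * hausdorffContent s E := by
  have hf : LipschitzWith r.toNNReal fun x : ℝ => r * x + b := by
    refine LipschitzWith.of_dist_le_mul fun x y => ?_
    rw [Real.coe_toNNReal _ hr.le, Real.dist_eq, Real.dist_eq,
      show r * x + b - (r * y + b) = r * (x - y) by ring, abs_mul, abs_of_pos hr]
  rw [← ENNReal.ofReal_rpow_of_pos hr]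
  exact hausdorffContent_image_le hs (Real.toNNReal_pos.2 hr).ne' hf E

/-- Since `s > 0`, a cover whose total sum is at most `r ^ s` has every diameter at most `r`, so the
mesh restriction costs nothing. -/
theorem hausdorffMeasure_eq_zero_of_hausdorffContent_eq_zero {s : ℝ} (hs : 0 < s) {E : Set ℝ}
    (h : hausdorffContent s E = 0) : Measure.hausdorffMeasure s E = 0 := by
  rw [Measure.hausdorffMeasure_apply]
  simp only [ENNReal.iSup_eq_zero]
  intro r hr
  refine le_antisymm (ENNReal.le_of_forall_pos_le_add fun ε hε _ => ?_) bot_le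
  have hr' : 0 < r ^ s := by
    rcases eq_or_ne r ⊤ with rfl | hr'
    · simp [hs]
    · exact ENNReal.rpow_pos hr hr'
  obtain ⟨t, ht, hlt⟩ := exists_cover_of_hausdorffContent_lt hs (E := E) (c := min (r ^ s) ε)
    (by rw [h]; exact lt_min hr' (by exact_mod_cast hε))
  refine iInf_le_of_le t (iInf_le_of_le ht (iInf_le_of_le (fun n => ?_) ?_))
  · rw [← ENNReal.rpow_le_rpow_iff hs]
    exact (ENNReal.le_tsum n).trans (hlt.le.trans (min_le_left _ _))
  · rw [zero_add]
    refine le_trans (ENNReal.tsum_le_tsum fun n => ?_) (hlt.le.trans (min_le_right _ _))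
    exact iSup_le fun _ => le_rfl

/-- Hausdorff content is upper semicontinuous on compact sets. -/
theorem exists_thickening_hausdorffContent_lt {s : ℝ} (hs : 0 < s) {E : Set ℝ} (hE : IsCompact E)
    {c : ENNReal} (h : hausdorffContent s E < c) :
    ∃ δ > 0, hausdorffContent s (Metric.thickening δ E) < c := by
  obtain ⟨t, ht, hlt⟩ := exists_cover_of_hausdorffContent_lt hs h
  -- The slack below `c` is shared among the covering sets, so that each can be fattened to an open
  -- set.
  obtain ⟨e, he, hesum⟩ := ENNReal.exists_pos_sum_of_countable'
    (tsub_pos_of_lt hlt).ne' ℕ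
  have hr : ∀ i, ∃ r : NNReal, 0 < r ∧
      (Metric.ediam (t i) + 2 * r) ^ s ≤ Metric.ediam (t i) ^ s + e i := by
    intro i
    have hne : Metric.ediam (t i) ^ s ≠ ⊤ :=
      (lt_of_le_of_lt (ENNReal.le_tsum i) hlt).ne_top
    have hcont : Tendsto (fun r : NNReal => (Metric.ediam (t i) + 2 * (r : ENNReal)) ^ s)
        (𝓝 0) (𝓝 ((Metric.ediam (t i) + 2 * ((0 : NNReal) : ENNReal)) ^ s)) := by
      refine ((ENNReal.continuous_rpow_const (y := s)).tendsto _).comp ?_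
      refine tendsto_const_nhds.add (ENNReal.Tendsto.const_mul ?_ (by simp))
      exact ENNReal.continuous_coe.tendsto 0
    rw [ENNReal.coe_zero, mul_zero, add_zero] at hcont
    have hev := hcont.eventually_lt_const
      (ENNReal.lt_add_right hne (he i).ne')
    have hev' : ∀ᶠ r : NNReal in 𝓝[>] 0,
        (Metric.ediam (t i) + 2 * (r : ENNReal)) ^ s < Metric.ediam (t i) ^ s + e i :=
      hev.filter_mono nhdsWithin_le_nhds
    obtain ⟨r, hr, hr'⟩ := (hev'.and self_mem_nhdsWithin).exists
    exact ⟨r, hr', hr.le⟩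
  choose r hr0 hr using hr
  have hsub : E ⊆ ⋃ i, Metric.thickening (r i : ℝ) (t i) :=
    ht.trans (Set.iUnion_mono fun i => Metric.self_subset_thickening (by exact_mod_cast hr0 i) _)
  obtain ⟨δ, hδ, hδsub⟩ := hE.exists_thickening_subset_open
    (isOpen_iUnion fun i => Metric.isOpen_thickening) hsub
  refine ⟨δ, hδ, ?_⟩
  calc hausdorffContent s (Metric.thickening δ E)
      ≤ ∑' i, Metric.ediam (Metric.thickening (r i : ℝ) (t i)) ^ s :=
        hausdorffContent_le_tsum hs hδsub
    _ ≤ ∑' i, (Metric.ediam (t i) ^ s + e i) := by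
        refine ENNReal.tsum_le_tsum fun i => le_trans ?_ (hr i)
        exact ENNReal.rpow_le_rpow (Metric.ediam_thickening_le _) hs.le
    _ = ∑' i, Metric.ediam (t i) ^ s + ∑' i, e i := ENNReal.tsum_add
    _ < ∑' i, Metric.ediam (t i) ^ s + (c - ∑' i, Metric.ediam (t i) ^ s) :=
        ENNReal.add_lt_add_left hlt.ne_top hesum
    _ = c := add_tsub_cancel_of_le hlt.le

theorem hausdorffContent_lt_top {s : ℝ} (hs : 0 < s) {E : Set ℝ} (hE : Bornology.IsBounded E) :
    hausdorffContent s E < ⊤ := by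
  have h : E ⊆ ⋃ i : ℕ, (if i = 0 then E else ∅) :=
    fun x hx => Set.mem_iUnion.2 ⟨0, by simpa using hx⟩
  refine lt_of_le_of_lt (hausdorffContent_le_tsum hs h) ?_
  rw [tsum_eq_single 0 (fun i hi => by simp [hi, ENNReal.zero_rpow_of_pos hs])]
  simpa using ENNReal.rpow_lt_top_of_nonneg hs.le hE.ediam_ne_top

/-! ### Homogeneous self-similar tilings. -/

/-- `C` is the union of `N` translates of `ρ * C`. -/
def IsTiledBy (C : Set ℝ) (ρ : ℝ) (N : ℕ) : Prop :=
  ∃ b : Fin N → ℝ, C = ⋃ i, (fun x => ρ * x + b i) '' C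

namespace IsTiledBy

variable {C C₁ C₂ : Set ℝ} {ρ σ ρ₁ ρ₂ : ℝ} {N M N₁ N₂ : ℕ}

theorem of_fintype {ι : Type*} [Fintype ι] (b : ι → ℝ)
    (h : C = ⋃ i, (fun x => ρ * x + b i) '' C) : IsTiledBy C ρ (Fintype.card ι) := by
  refine ⟨fun i => b ((Fintype.equivFin ι).symm i), ?_⟩
  rw [(Fintype.equivFin ι).symm.surjective.iUnion_comp (fun i => (fun x => ρ * x + b i) '' C)]
  exact h

theorem mul (h : IsTiledBy C ρ N) (h' : IsTiledBy C σ M) : IsTiledBy C (ρ * σ) (N * M) := by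
  obtain ⟨b, hb⟩ := h
  obtain ⟨c, hc⟩ := h'
  have key : C = ⋃ p : Fin N × Fin M, (fun x => ρ * σ * x + (ρ * c p.2 + b p.1)) '' C := by
    conv_lhs => rw [hb]
    rw [Set.iUnion_prod']
    refine Set.iUnion_congr fun i => ?_
    conv_lhs => rw [hc]
    rw [Set.image_iUnion]
    refine Set.iUnion_congr fun j => ?_
    rw [Set.image_image]
    refine Set.image_congr fun x _ => ?_
    ring
  simpa using of_fintype _ key

theorem one : IsTiledBy C 1 1 := ⟨fun _ => 0, by simp [Set.iUnion_const]⟩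

theorem pow (h : IsTiledBy C ρ N) (n : ℕ) : IsTiledBy C (ρ ^ n) (N ^ n) := by
  induction n with
  | zero => simpa using one
  | succ n ih => simpa only [pow_succ] using ih.mul h

/-- The piece containing `0` cannot extend left of `0`, and the piece containing `1` cannot extend
right of `1`; this pins their shifts. -/
theorem exists_shifts (h : IsTiledBy C ρ N) (hρ : 0 < ρ) (hC : C ⊆ Set.Icc 0 1) (h0 : 0 ∈ C)
    (h1 : 1 ∈ C) :
    ∃ b : Fin N → ℝ, C = (⋃ i, (fun x => ρ * x + b i) '' C) ∧ (∃ i, b i = 0) ∧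
      ∃ j, b j = 1 - ρ := by
  obtain ⟨b, hb⟩ := h
  have hmem : ∀ i, ∀ x ∈ C, ρ * x + b i ∈ Set.Icc (0 : ℝ) 1 := fun i x hx =>
    hC (by rw [hb]; exact Set.mem_iUnion.2 ⟨i, x, hx, rfl⟩)
  refine ⟨b, hb, ?_, ?_⟩
  · obtain ⟨i, x, hx, hxi⟩ := Set.mem_iUnion.1 (hb ▸ h0)
    have := (hmem i 0 h0).1
    have := mul_nonneg hρ.le (hC hx).1
    simp only at hxi
    exact ⟨i, by linarith⟩
  · obtain ⟨i, x, hx, hxi⟩ := Set.mem_iUnion.1 (hb ▸ h1)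
    have := (hmem i 1 h1).2
    have := mul_le_mul_of_nonneg_left (hC hx).2 hρ.le
    simp only at hxi
    exact ⟨i, by linarith⟩

end IsTiledBy

/-! ### Pieces of the sums `C₁ + t • C₂`. -/

/-- If `C₁` and `C₂` are unions of scaled copies of themselves, then `C₁ + t • C₂` is a union of
scaled copies of `C₁ + (t * (ρ₂ / ρ₁)) • C₂`. -/
theorem add_smul_eq_iUnion {ι κ : Type*} {C₁ C₂ : Set ℝ} {ρ₁ ρ₂ : ℝ} {b : ι → ℝ} {c : κ → ℝ}
    (hρ₁ : 0 < ρ₁) (hb : C₁ = ⋃ i, (fun x => ρ₁ * x + b i) '' C₁)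
    (hc : C₂ = ⋃ i, (fun x => ρ₂ * x + c i) '' C₂) (t : ℝ) :
    C₁ + t • C₂ = ⋃ p : ι × κ,
      (fun x => ρ₁ * x + (b p.1 + t * c p.2)) '' (C₁ + (t * (ρ₂ / ρ₁)) • C₂) := by
  conv_lhs => rw [hb, hc]
  ext z
  simp only [Set.mem_add, Set.mem_smul_set, Set.mem_iUnion, Set.mem_image, Prod.exists,
    smul_eq_mul]
  constructor
  · rintro ⟨_, ⟨i, x, hx, rfl⟩, _, ⟨_, ⟨j, y, hy, rfl⟩, rfl⟩, rfl⟩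
    refine ⟨i, j, _, ⟨x, hx, _, ⟨y, hy, rfl⟩, rfl⟩, ?_⟩
    field_simp
    ring
  · rintro ⟨i, j, _, ⟨x, hx, _, ⟨y, hy, rfl⟩, rfl⟩, rfl⟩
    refine ⟨_, ⟨i, x, hx, rfl⟩, _, ⟨_, ⟨j, y, hy, rfl⟩, rfl⟩, ?_⟩
    field_simp
    ring

theorem hausdorffContent_add_smul_le {s : ℝ} (hs : 0 < s) {C₁ C₂ : Set ℝ} {ρ₁ ρ₂ : ℝ}
    {N₁ N₂ : ℕ} (hρ₁ : 0 < ρ₁) (h₁ : IsTiledBy C₁ ρ₁ N₁) (h₂ : IsTiledBy C₂ ρ₂ N₂) (t : ℝ) :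
    hausdorffContent s (C₁ + t • C₂) ≤
      (N₁ * N₂ : ℕ) *
        (ENNReal.ofReal (ρ₁ ^ s) * hausdorffContent s (C₁ + (t * (ρ₂ / ρ₁)) • C₂)) := by
  obtain ⟨b, hb⟩ := h₁
  obtain ⟨c, hc⟩ := h₂
  rw [add_smul_eq_iUnion hρ₁ hb hc t]
  refine (measure_iUnion_fintype_le _ _).trans ?_
  refine (Finset.sum_le_sum fun p _ => hausdorffContent_image_mul_add_le hs hρ₁ _ _).trans ?_
  simp

/-- If both sets have extreme points `0` and `1`, two of the pieces of `C₁ + C₂` are translates of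
one another by `ρ₁ - ρ₂`, and may be covered together. -/
theorem hausdorffContent_add_add_le {s : ℝ} (hs : 0 < s) {C₁ C₂ : Set ℝ} {ρ₁ ρ₂ : ℝ}
    {N₁ N₂ : ℕ} (hρ₁ : 0 < ρ₁) (hρ₁' : ρ₁ < 1) (hρ₂ : 0 < ρ₂)
    (h₁ : IsTiledBy C₁ ρ₁ N₁) (h₂ : IsTiledBy C₂ ρ₂ N₂)
    (hC₁ : C₁ ⊆ Set.Icc 0 1) (hC₂ : C₂ ⊆ Set.Icc 0 1)
    (h₁0 : 0 ∈ C₁) (h₁1 : 1 ∈ C₁) (h₂0 : 0 ∈ C₂) (h₂1 : 1 ∈ C₂)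
    {u : ℝ} (hu : u = ρ₂ / ρ₁) :
    hausdorffContent s (C₁ + (1 : ℝ) • C₂) +
        2 * (ENNReal.ofReal (ρ₁ ^ s) * hausdorffContent s (C₁ + u • C₂)) ≤
      (N₁ * N₂ : ℕ) * (ENNReal.ofReal (ρ₁ ^ s) * hausdorffContent s (C₁ + u • C₂)) +
        ENNReal.ofReal (ρ₁ ^ s) * hausdorffContent s
          ((C₁ + u • C₂) ∪ (fun x => x + (1 - u)) '' (C₁ + u • C₂)) := by
  classical
  obtain ⟨b, hb, ⟨i₀, hi₀⟩, ⟨i₁, hi₁⟩⟩ := h₁.exists_shifts hρ₁ hC₁ h₁0 h₁1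
  obtain ⟨c, hc, ⟨j₀, hj₀⟩, ⟨j₁, hj₁⟩⟩ := h₂.exists_shifts hρ₂ hC₂ h₂0 h₂1
  have hne : i₀ ≠ i₁ := by
    rintro rfl
    -- Equal indices would give `0 = 1 - ρ₁`, against `ρ₁ < 1`.
    linarith
  have hpq : ((i₁, j₀) : Fin N₁ × Fin N₂) ≠ (i₀, j₁) := fun h => hne (Prod.ext_iff.1 h).1.symm
  have hun := add_smul_eq_iUnion hρ₁ hb hc 1
  rw [one_mul, ← hu] at hun
  set K := C₁ + u • C₂ with hK
  set X := ENNReal.ofReal (ρ₁ ^ s) * hausdorffContent s K with hX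
  set Y := ENNReal.ofReal (ρ₁ ^ s) *
    hausdorffContent s (K ∪ (fun x => x + (1 - u)) '' K) with hY
  -- The corner pieces: their shifts are `1 - ρ₁` and `1 - ρ₂`, which differ by `1 - u` after
  -- rescaling by `ρ₁`.
  set T : Finset (Fin N₁ × Fin N₂) := {(i₁, j₀), (i₀, j₁)} with hT
  have hTcard : T.card = 2 := Finset.card_pair hpq
  have hcard : T.card + Tᶜ.card = N₁ * N₂ := by
    rw [Finset.card_add_card_compl]
    simp
  have hsub : C₁ + (1 : ℝ) • C₂ ⊆
      ((fun x => ρ₁ * x + (1 - ρ₁)) '' (K ∪ (fun x => x + (1 - u)) '' K)) ∪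
        ⋃ p ∈ Tᶜ, (fun x => ρ₁ * x + (b p.1 + 1 * c p.2)) '' K := by
    rw [hun]
    refine Set.iUnion_subset fun p => ?_
    by_cases hp : p ∈ T
    · refine Set.subset_union_of_subset_left ?_ _
      rw [hT, Finset.mem_insert, Finset.mem_singleton] at hp
      rcases hp with rfl | rfl
      · rintro _ ⟨x, hx, rfl⟩
        refine ⟨x, Or.inl hx, ?_⟩
        simp only [hi₁, hj₀]
        ring
      · rintro _ ⟨x, hx, rfl⟩
        refine ⟨x + (1 - u), Or.inr ⟨x, hx, rfl⟩, ?_⟩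
        simp only [hi₀, hj₁, hu]
        field_simp
        ring
    · refine Set.subset_union_of_subset_right ?_ _
      exact Set.subset_iUnion₂_of_subset p (Finset.mem_compl.2 hp) le_rfl
  have hle : hausdorffContent s (C₁ + (1 : ℝ) • C₂) ≤ Y + (Tᶜ.card : ENNReal) * X := by
    refine (measure_mono hsub).trans ((measure_union_le _ _).trans (add_le_add ?_ ?_))
    · exact hausdorffContent_image_mul_add_le hs hρ₁ _ _
    · refine (measure_biUnion_finset_le _ _).trans ?_
      refine (Finset.sum_le_sum fun p _ => hausdorffContent_image_mul_add_le hs hρ₁ _ _).trans ?_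
      simp [hX]
  calc _ ≤ (Y + (Tᶜ.card : ENNReal) * X) + 2 * X := by gcongr
    _ = (N₁ * N₂ : ℕ) * X + Y := by
      rw [← hcard, hTcard]
      push_cast
      ring

theorem add_smul_subset_thickening {C₁ C₂ : Set ℝ} (hC₂ : C₂ ⊆ Set.Icc 0 1) {δ t u : ℝ}
    (h : |t - u| < δ) : C₁ + t • C₂ ⊆ Metric.thickening δ (C₁ + u • C₂) := by
  rintro _ ⟨x, hx, _, ⟨y, hy, rfl⟩, rfl⟩
  refine Metric.mem_thickening_iff.2 ⟨x + u * y, ⟨x, hx, _, ⟨y, hy, rfl⟩, rfl⟩, ?_⟩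
  have := hC₂ hy
  change |x + t * y - (x + u * y)| < δ
  rw [show x + t * y - (x + u * y) = (t - u) * y by ring, abs_mul, abs_of_nonneg this.1]
  exact lt_of_le_of_lt (mul_le_of_le_one_right (abs_nonneg _) this.2) h

/-! ### Recurrence of the ratios `g ^ m / l ^ n`. -/

/-- Simultaneous recurrence: a ratio of large powers may be taken arbitrarily close to `1`. -/
theorem frequently_pow_div_pow_nhds_one {l g : ℝ} (hl : 0 < l) (hl' : l < 1) (hg : 0 < g)
    (hg' : g < 1) (N : ℕ) :
    ∃ᶠ t in 𝓝 (1 : ℝ), ∃ n m : ℕ, N ≤ n ∧ N ≤ m ∧ t = g ^ m / l ^ n := by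
  set a := -Real.log l with ha
  set b := -Real.log g with hb
  have ha0 : 0 < a := neg_pos.2 (Real.log_neg hl hl')
  have hb0 : 0 < b := neg_pos.2 (Real.log_neg hg hg')
  -- Dirichlet approximation is applied to `q * a / b` rather than `a / b`: its denominator `k` may
  -- be as small as `1`, and this `q` still forces both `k * q` and `j` to be at least `N`. The `+
  -- 1` absorbs the approximation error.
  obtain ⟨q, hq⟩ := exists_nat_ge (max ((N : ℝ) + 1) (((N : ℝ) + 1) * b / a))
  have hqN : (N : ℝ) + 1 ≤ q := (le_max_left _ _).trans hq
  have hqξ : (N : ℝ) + 1 ≤ q * a / b := by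
    have := (le_max_right _ _).trans hq
    rw [div_le_iff₀ ha0] at this
    rwa [le_div_iff₀ hb0]
  rw [Filter.frequently_iff]
  intro U hU
  have hexp : Tendsto (fun x : ℝ => Real.exp x) (𝓝 0) (𝓝 1) := by
    simpa using Real.continuous_exp.tendsto 0
  obtain ⟨ε, hε, hεU⟩ := Metric.mem_nhds_iff.1 (hexp hU)
  obtain ⟨Q, hQ⟩ := exists_nat_gt (b / ε)
  have hQ0 : 0 < Q := by
    have : (0 : ℝ) < Q := (div_pos hb0 hε).trans hQ
    exact_mod_cast this
  obtain ⟨j, k, hk, -, hjk⟩ := Real.exists_int_int_abs_mul_sub_le (q * a / b) hQ0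
  have hk1 : (1 : ℝ) ≤ k := by exact_mod_cast hk
  have hQ1 : (1 : ℝ) / (Q + 1) ≤ 1 := by
    rw [div_le_one (by positivity)]
    linarith [Nat.cast_nonneg (α := ℝ) Q]
  have hjN : (N : ℝ) ≤ j := by
    have h1 := (abs_le.1 hjk).2
    have h2 : q * a / b ≤ k * (q * a / b) := le_mul_of_one_le_left (by positivity) hk1
    linarith
  have hkz : ((k.toNat : ℤ) : ℝ) = k := by rw [Int.toNat_of_nonneg hk.le]
  have hj0 : 0 ≤ j := by
    have : (0 : ℝ) ≤ j := (Nat.cast_nonneg N).trans hjN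
    exact_mod_cast this
  have hjz : ((j.toNat : ℤ) : ℝ) = j := by rw [Int.toNat_of_nonneg hj0]
  rw [Int.cast_natCast] at hkz hjz
  refine ⟨_, ?_, k.toNat * q, j.toNat, ?_, ?_, rfl⟩
  · have key : g ^ j.toNat / l ^ (k.toNat * q) = Real.exp (b * (k * (q * a / b) - j)) := by
      rw [← Real.exp_log (pow_pos hg j.toNat), ← Real.exp_log (pow_pos hl (k.toNat * q)),
        ← Real.exp_sub, Real.log_pow, Real.log_pow, Nat.cast_mul, hkz, hjz]
      congr 1
      field_simp
      rw [ha, hb]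
      ring
    rw [key]
    refine hεU (a := b * (k * (q * a / b) - j)) ?_
    rw [mem_ball_zero_iff, Real.norm_eq_abs, abs_mul, abs_of_pos hb0]
    calc b * |k * (q * a / b) - j| ≤ b * (1 / (Q + 1)) := by gcongr
      _ < ε := by
        rw [mul_one_div, div_lt_iff₀ (by positivity)]
        rw [div_lt_iff₀ hε] at hQ
        linarith
  · have : (N : ℝ) ≤ ((k.toNat * q : ℕ) : ℝ) := by
      rw [Nat.cast_mul, hkz]
      have : (q : ℝ) ≤ k * q := le_mul_of_one_le_left (Nat.cast_nonneg _) hk1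
      linarith
    exact_mod_cast this
  · rw [← hjz] at hjN
    exact_mod_cast hjN

/-! ### Normalization and exponents. -/

theorem zero_mem_and_one_mem_of_closedConvexHull_eq {C : Set ℝ} (hne : C.Nonempty)
    (hC : IsCompact C) (h : closedConvexHull ℝ C = Set.Icc 0 1) :
    C ⊆ Set.Icc 0 1 ∧ 0 ∈ C ∧ 1 ∈ C := by
  have hsub : C ⊆ Set.Icc 0 1 := h ▸ subset_closedConvexHull
  have hmin : Set.Icc (0 : ℝ) 1 ⊆ Set.Icc (sInf C) (sSup C) := by
    rw [← h]
    exact closedConvexHull_min (fun x hx => ⟨csInf_le hC.bddBelow hx, le_csSup hC.bddAbove hx⟩)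
      (convex_Icc _ _) isClosed_Icc
  have h0 := hC.sInf_mem hne
  have h1 := hC.sSup_mem hne
  have e0 : sInf C = 0 := le_antisymm (hmin ⟨le_rfl, zero_le_one⟩).1 (hsub h0).1
  have e1 : sSup C = 1 := le_antisymm (hsub h1).2 (hmin ⟨zero_le_one, le_rfl⟩).2
  exact ⟨hsub, e0 ▸ h0, e1 ▸ h1⟩

/-- This identifies the number of pieces times their scaling factor as `u ^ (-d₂)`, where `u = g ^ m
/ l ^ n`. -/
theorem natCast_pow_mul_rpow_eq_one {l g d₁ d₂ : ℝ} {A B : ℕ} (hl : 0 < l) (hg : 0 < g)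
    (hA : A * l ^ d₁ = 1) (hB : B * g ^ d₂ = 1) (n m : ℕ) :
    ((A ^ n * B ^ m : ℕ) : ℝ) * (l ^ n) ^ (d₁ + d₂) * (g ^ m / l ^ n) ^ d₂ = 1 := by
  have hln : 0 < l ^ n := pow_pos hl n
  have e1 : (l ^ n) ^ d₁ = (l ^ d₁) ^ n := by
    rw [← Real.rpow_natCast, ← Real.rpow_natCast, ← Real.rpow_mul hl.le, ← Real.rpow_mul hl.le,
      mul_comm]
  have e2 : (g ^ m) ^ d₂ = (g ^ d₂) ^ m := by
    rw [← Real.rpow_natCast, ← Real.rpow_natCast, ← Real.rpow_mul hg.le, ← Real.rpow_mul hg.le,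
      mul_comm]
  have h0 : (l ^ n) ^ d₂ ≠ 0 := (Real.rpow_pos_of_pos hln d₂).ne'
  rw [Real.rpow_add hln, Real.div_rpow (pow_pos hg m).le hln.le, e1, e2]
  push_cast
  calc _ = (A * l ^ d₁) ^ n * (B * g ^ d₂) ^ m := by
        field_simp
        ring
    _ = 1 := by rw [hA, hB, one_pow, one_pow, one_mul]

/-! ### Vanishing of the content. -/

theorem hausdorffContent_add_eq_zero {C₁ C₂ : Set ℝ} {l g d₁ d₂ : ℝ} {A B : ℕ}
    (hl : 0 < l) (hl' : l < 1) (hg : 0 < g) (hg' : g < 1)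
    (h₁ : IsTiledBy C₁ l A) (h₂ : IsTiledBy C₂ g B)
    (hK₁ : IsCompact C₁) (hK₂ : IsCompact C₂)
    (hC₁ : C₁ ⊆ Set.Icc 0 1) (hC₂ : C₂ ⊆ Set.Icc 0 1)
    (h₁0 : 0 ∈ C₁) (h₁1 : 1 ∈ C₁) (h₂0 : 0 ∈ C₂) (h₂1 : 1 ∈ C₂)
    (hA : A * l ^ d₁ = 1) (hB : B * g ^ d₂ = 1) (hs : 0 < d₁ + d₂) :
    hausdorffContent (d₁ + d₂) (C₁ + C₂) = 0 := by
  set s := d₁ + d₂ with hsdef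
  have hcomp : ∀ t : ℝ, IsCompact (C₁ + t • C₂) := fun t => hK₁.add (hK₂.smul t)
  have hfin : ∀ t : ℝ, hausdorffContent s (C₁ + t • C₂) ≠ ⊤ := fun t =>
    (hausdorffContent_lt_top hs (hcomp t).isBounded).ne
  set f : ℝ → ℝ := fun t => (hausdorffContent s (C₁ + t • C₂)).toReal with hf
  have hf0 : ∀ t, 0 ≤ f t := fun t => ENNReal.toReal_nonneg
  have hu0 : ∀ n m : ℕ, 0 < g ^ m / l ^ n := fun n m => div_pos (pow_pos hg m) (pow_pos hl n)
  have hmono : ∀ (t : ℝ) (n m : ℕ), (g ^ m / l ^ n) ^ d₂ * f t ≤ f (t * (g ^ m / l ^ n)) := by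
    intro t n m
    have h := hausdorffContent_add_smul_le hs (pow_pos hl n) (h₁.pow n) (h₂.pow m) t
    have hr := ENNReal.toReal_mono (by finiteness [hfin (t * (g ^ m / l ^ n))]) h
    rw [ENNReal.toReal_mul, ENNReal.toReal_mul, ENNReal.toReal_natCast,
      ENNReal.toReal_ofReal (by positivity)] at hr
    have h1 := natCast_pow_mul_rpow_eq_one hl hg hA hB n m
    have hpos := Real.rpow_pos_of_pos (hu0 n m) d₂
    calc (g ^ m / l ^ n) ^ d₂ * f t ≤ (g ^ m / l ^ n) ^ d₂ *
          (((A ^ n * B ^ m : ℕ) : ℝ) * ((l ^ n) ^ s * f (t * (g ^ m / l ^ n)))) := by gcongr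
      _ = (((A ^ n * B ^ m : ℕ) : ℝ) * (l ^ n) ^ s * (g ^ m / l ^ n) ^ d₂) *
          f (t * (g ^ m / l ^ n)) := by ring
      _ = f (t * (g ^ m / l ^ n)) := by rw [h1, one_mul]
  have husc : ∀ η > 0, ∃ δ > 0,
      hausdorffContent s (Metric.thickening δ (C₁ + (1 : ℝ) • C₂)) < ENNReal.ofReal (f 1 + η) := by
    intro η hη
    refine exists_thickening_hausdorffContent_lt hs (hcomp 1) ?_
    rw [ENNReal.lt_ofReal_iff_toReal_lt (hfin 1)]
    exact lt_add_of_pos_right _ hη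
  have hle_of_subset : ∀ {η δ : ℝ} {E : Set ℝ}, 0 < η →
      hausdorffContent s (Metric.thickening δ (C₁ + (1 : ℝ) • C₂)) < ENNReal.ofReal (f 1 + η) →
      E ⊆ Metric.thickening δ (C₁ + (1 : ℝ) • C₂) → (hausdorffContent s E).toReal ≤ f 1 + η := by
    intro η δ E hη hδ hE
    exact ENNReal.toReal_le_of_le_ofReal (add_nonneg (hf0 1) hη.le)
      ((measure_mono hE).trans hδ.le)
  have hpow1 : ∀ c : ℝ, Tendsto (fun w : ℝ => w ^ c) (𝓝 1) (𝓝 1) := fun c => by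
    simpa using (Real.continuousAt_rpow_const 1 c (Or.inl one_ne_zero)).tendsto
  have hupper : ∀ n m : ℕ, f (g ^ m / l ^ n) ≤ (g ^ m / l ^ n) ^ d₂ * f 1 := by
    intro n m
    set u := g ^ m / l ^ n with hu
    have hupos : 0 < u := hu0 n m
    refine le_of_forall_pos_le_add fun ε hε => ?_
    have hud : 0 < u ^ d₂ := Real.rpow_pos_of_pos hupos d₂
    obtain ⟨δ, hδ, hδlt⟩ := husc (ε / (2 * u ^ d₂)) (by positivity)
    have hlim : Tendsto (fun w : ℝ => u ^ d₂ * (f 1 + ε / (2 * u ^ d₂)) * w ^ (-d₂)) (𝓝 1)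
        (𝓝 (u ^ d₂ * (f 1 + ε / (2 * u ^ d₂)))) := by
      simpa using (hpow1 (-d₂)).const_mul (u ^ d₂ * (f 1 + ε / (2 * u ^ d₂)))
    have hlt : u ^ d₂ * (f 1 + ε / (2 * u ^ d₂)) < u ^ d₂ * f 1 + ε := by
      rw [mul_add, show u ^ d₂ * (ε / (2 * u ^ d₂)) = ε / 2 by field_simp]
      linarith
    -- Exponents at least `max n m` make `w / u` a ratio of the same form, so `hmono` leads from `u`
    -- to `w`, where semicontinuity at `1` bounds `f w`.
    obtain ⟨w, ⟨n', m', hn, hm, hw⟩, hw1, hw2⟩ :=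
      ((frequently_pow_div_pow_nhds_one hl hl' hg hg' (max n m)).and_eventually
        ((hlim.eventually_lt_const hlt).and (Metric.ball_mem_nhds 1 hδ))).exists
    obtain ⟨p, rfl⟩ := Nat.exists_eq_add_of_le ((le_max_left _ _).trans hn)
    obtain ⟨q, rfl⟩ := Nat.exists_eq_add_of_le ((le_max_right _ _).trans hm)
    have hwv : w = u * (g ^ q / l ^ p) := by
      rw [hw, hu, pow_add, pow_add]
      field_simp
    have hwpos : 0 < w := hw ▸ hu0 _ _
    have hfw : f w ≤ f 1 + ε / (2 * u ^ d₂) := by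
      refine hle_of_subset (by positivity) hδlt (add_smul_subset_thickening hC₂ ?_)
      rwa [← Real.dist_eq]
    have hstep := hmono u p q
    rw [← hwv] at hstep
    have hwd : w ^ d₂ = u ^ d₂ * (g ^ q / l ^ p) ^ d₂ := by
      rw [hwv, Real.mul_rpow hupos.le (hu0 p q).le]
    have hwd0 : 0 < w ^ d₂ := Real.rpow_pos_of_pos hwpos d₂
    calc f u = (u ^ d₂ * (g ^ q / l ^ p) ^ d₂ * f u) * w ^ (-d₂) := by
          rw [← hwd, Real.rpow_neg hwpos.le]
          field_simp
      _ = u ^ d₂ * ((g ^ q / l ^ p) ^ d₂ * f u) * w ^ (-d₂) := by ring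
      _ ≤ u ^ d₂ * (f 1 + ε / (2 * u ^ d₂)) * w ^ (-d₂) := by
          gcongr
          exact hstep.trans hfw
      _ ≤ u ^ d₂ * f 1 + ε := hw1.le
  have hf1 : f 1 = 0 := by
    by_contra hne
    have hpos : 0 < f 1 := lt_of_le_of_ne (hf0 1) (Ne.symm hne)
    -- The constants clash: the joint cover gives `2 * f u ≤ 3 / 2 * f 1`, while `hmono` with `u ^
    -- d₂ > 3 / 4` gives `f u > 3 / 4 * f 1`.
    obtain ⟨δ, hδ, hδlt⟩ := husc (f 1 / 2) (by positivity)
    obtain ⟨u, ⟨n, m, hn, hm, hu⟩, hu1, hu2⟩ :=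
      ((frequently_pow_div_pow_nhds_one hl hl' hg hg' 1).and_eventually
        (((hpow1 d₂).eventually_const_lt (show (3 / 4 : ℝ) < 1 by norm_num)).and
          (Metric.ball_mem_nhds 1 (half_pos hδ)))).exists
    rw [Real.dist_eq] at hu2
    have hln1 : l ^ n < 1 := pow_lt_one₀ hl.le hl' (by omega)
    have hB' := hausdorffContent_add_add_le hs (pow_pos hl n) hln1 (pow_pos hg m) (h₁.pow n)
      (h₂.pow m) hC₁ hC₂ h₁0 h₁1 h₂0 h₂1 hu
    set V := (C₁ + u • C₂) ∪ (fun x => x + (1 - u)) '' (C₁ + u • C₂) with hV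
    have hVsub : V ⊆ Metric.thickening δ (C₁ + (1 : ℝ) • C₂) := by
      -- Half of `δ` pays for changing the parameter from `u` to `1`, the other half for the
      -- translation by `1 - u`.
      have h1 := add_smul_subset_thickening (C₁ := C₁) hC₂ hu2
      refine Set.union_subset (h1.trans (Metric.thickening_mono (by linarith) _)) ?_
      rintro _ ⟨x, hx, rfl⟩
      obtain ⟨z, hz, hxz⟩ := Metric.mem_thickening_iff.1 (h1 hx)
      refine Metric.mem_thickening_iff.2 ⟨z, hz, ?_⟩
      rw [Real.dist_eq] at hxz ⊢
      rw [abs_lt] at *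
      constructor <;> linarith
    have hVle := hle_of_subset (by positivity) hδlt hVsub
    have hVfin : hausdorffContent s V ≠ ⊤ :=
      ne_top_of_le_ne_top ENNReal.ofReal_ne_top ((measure_mono hVsub).trans hδlt.le)
    have hr := ENNReal.toReal_mono (by finiteness [hfin u, hVfin]) hB'
    rw [ENNReal.toReal_add (hfin 1) (by finiteness [hfin u]),
      ENNReal.toReal_add (by finiteness [hfin u]) (by finiteness [hVfin])] at hr
    simp only [ENNReal.toReal_mul, ENNReal.toReal_natCast, ENNReal.toReal_ofNat] at hr
    rw [ENNReal.toReal_ofReal (by positivity)] at hr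
    change f 1 + 2 * ((l ^ n) ^ s * f u) ≤ ((A ^ n * B ^ m : ℕ) : ℝ) * ((l ^ n) ^ s * f u) + _
      at hr
    have hL : 0 < (l ^ n) ^ s := Real.rpow_pos_of_pos (pow_pos hl n) s
    have h1 := natCast_pow_mul_rpow_eq_one hl hg hA hB n m
    rw [← hu] at h1
    have hup := hupper n m
    have hlow := hmono 1 n m
    rw [one_mul, ← hu] at hlow
    rw [← hu] at hup
    -- By `hupper` the piecewise cover costs no more than `f 1`, so in `hr` the two corner pieces
    -- cannot be covered more cheaply together.
    have hcount : ((A ^ n * B ^ m : ℕ) : ℝ) * ((l ^ n) ^ s * f u) ≤ f 1 := by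
      calc _ ≤ ((A ^ n * B ^ m : ℕ) : ℝ) * ((l ^ n) ^ s * (u ^ d₂ * f 1)) := by gcongr
        _ = (((A ^ n * B ^ m : ℕ) : ℝ) * (l ^ n) ^ s * u ^ d₂) * f 1 := by ring
        _ = f 1 := by rw [h1, one_mul]
    have h2 : 2 * f u ≤ (hausdorffContent s V).toReal := by
      refine le_of_mul_le_mul_left ?_ hL
      linarith
    have h3 : 3 / 4 * f 1 < u ^ d₂ * f 1 := mul_lt_mul_of_pos_right hu1 hpos
    linarith
  rw [hf, ENNReal.toReal_eq_zero_iff, one_smul] at hf1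
  refine hf1.resolve_right ?_
  simpa using hfin 1

/-! ### From iterated function systems to tilings. -/

namespace AffineIFS

variable {ι : Type*} [Fintype ι]

theorem exists_isTiledBy (F : AffineIFS ι) {C : Set ℝ} {d : ℝ} (hF : F.IsHomogeneous)
    (hFo : F.IsOrientationPreserving) (hC : F.IsAttractor C)
    (hull : closedConvexHull ℝ C = Set.Icc 0 1) (hd : F.IsSimilarityDimension d) :
    ∃ l : ℝ, 0 < l ∧ l < 1 ∧ IsTiledBy C l (Fintype.card ι) ∧ Fintype.card ι * l ^ d = 1 ∧
      0 < d := by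
  obtain ⟨hne, hcomp, heq⟩ := hC
  obtain ⟨hsub, h0, h1⟩ := zero_mem_and_one_mem_of_closedConvexHull_eq hne hcomp hull
  obtain ⟨i₀, -⟩ := Set.mem_iUnion.1 (heq ▸ h0)
  have hrate : ∀ i, F.rate i = F.rate i₀ := fun i => hF i i₀
  have hmap : ∀ i, F.map i = fun x => F.rate i₀ * x + F.shift i := fun i => by
    funext x
    rw [AffineIFS.map, hFo i, hrate i, one_mul]
  have htile : IsTiledBy C (F.rate i₀) (Fintype.card ι) := by
    refine IsTiledBy.of_fintype F.shift ?_
    simpa only [hmap] using heq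
  have hcard : Fintype.card ι * F.rate i₀ ^ d = 1 := by
    have h := hd
    unfold IsSimilarityDimension at h
    simpa [hrate] using h
  refine ⟨F.rate i₀, F.rate_pos i₀, F.rate_lt_one i₀, htile, hcard, ?_⟩
  -- The pieces at `0` and at `1` are distinct, so there are at least two maps, which forces `d >
  -- 0`.
  obtain ⟨b, -, ⟨i, hi⟩, ⟨j, hj⟩⟩ := htile.exists_shifts (F.rate_pos i₀) hsub h0 h1
  have hij : i ≠ j := by
    rintro rfl
    linarith [F.rate_lt_one i₀]
  have hcard2 : 1 < Fintype.card ι := by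
    have := Fintype.one_lt_card_iff.2 ⟨i, j, hij⟩
    rwa [Fintype.card_fin] at this
  by_contra hd0
  have h1le := Real.one_le_rpow_of_pos_of_le_one_of_nonpos (F.rate_pos i₀) (F.rate_lt_one i₀).le
    (not_lt.1 hd0)
  have hc : (1 : ℝ) < Fintype.card ι := by exact_mod_cast hcard2
  nlinarith

end AffineIFS

theorem mainTheorem2 {ι κ : Type*} [Fintype ι] [Fintype κ]
    (F : AffineIFS ι) (G : AffineIFS κ) (C₁ C₂ : Set ℝ) (d₁ d₂ : ℝ)
    (hF : F.IsHomogeneous) (hG : G.IsHomogeneous)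
    (hFo : F.IsOrientationPreserving) (hGo : G.IsOrientationPreserving)
    (hC₁ : F.IsAttractor C₁) (hC₂ : G.IsAttractor C₂)
    (hull₁ : closedConvexHull ℝ C₁ = Set.Icc 0 1)
    (hull₂ : closedConvexHull ℝ C₂ = Set.Icc 0 1)
    (hd₁ : F.IsSimilarityDimension d₁) (hd₂ : G.IsSimilarityDimension d₂) :
    MeasureTheory.Measure.hausdorffMeasure (d₁ + d₂) (C₁ + C₂) = 0 := by
  obtain ⟨l, hl, hl', ht₁, hA, hd₁0⟩ := F.exists_isTiledBy hF hFo hC₁ hull₁ hd₁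
  obtain ⟨g, hg, hg', ht₂, hB, hd₂0⟩ := G.exists_isTiledBy hG hGo hC₂ hull₂ hd₂
  obtain ⟨hsub₁, h₁0, h₁1⟩ := zero_mem_and_one_mem_of_closedConvexHull_eq hC₁.1 hC₁.2.1 hull₁
  obtain ⟨hsub₂, h₂0, h₂1⟩ := zero_mem_and_one_mem_of_closedConvexHull_eq hC₂.1 hC₂.2.1 hull₂
  have hs : 0 < d₁ + d₂ := add_pos hd₁0 hd₂0
  exact hausdorffMeasure_eq_zero_of_hausdorffContent_eq_zero hs
    (hausdorffContent_add_eq_zero hl hl' hg hg' ht₁ ht₂ hC₁.2.1 hC₂.2.1 hsub₁ hsub₂ h₁0 h₁1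
      h₂0 h₂1 hA hB hs)
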